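/- Let $K$ be an infinite field, let $S=K[x_1,\dots,x_c]$ be a polynomial ring in finitely many variables, and let $X$ be an $m\times n$ matrix whose entries are linear forms of $S$ (homogeneous polynomials of degree $1$, the zero polynomial being allowed). Let $y$ be a new variable. For a matrix $Y$ over a commutative ring $R$ let $I_j(Y)$ denote the ideal of $R$ generated by the $j\times j$ minors of $Y$ (so $I_0(Y)=R$, which has height $\infty$ by convention, and $I_j(Y)=0$ for $j>\min\{m,n\}$). For $A\in M_{mn}(K)$ the ideal $I_j(X)$ is taken in $S$ and the ideal $I_j(X+yA)$ in $S[y]$. Then: (1) For every $A\in M_{mn}(K)$ and every integer $j\ge 0$, $$\operatorname{height} I_j(X)\le \operatorname{height} I_j(X+yA)\le \operatorname{height} I_j(X)+1 .$$ (2) There exists $A\in M_{mn}(K)$ such that, for every $j$ with $1\le j\le \min\{m,n\}$ simultaneously, $$\operatorname{height} I_j(X+yA)=\min\{(m+1-j)(n+1-j),\ \operatorname{height} I_j(X)+1\}.$$ -/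

import Mathlib

/-- The ideal `I_j(X)` generated by the minors of size `j` of an `m × n` matrix `X`: the determinants
of the submatrices given by `j` rows and `j` columns, each listed in increasing order.
It is the unit ideal for `j = 0` and the zero ideal for `j > min m n`. -/
def minorsIdeal {R : Type*} [CommRing R] {m n : ℕ} (j : ℕ) (X : Matrix (Fin m) (Fin n) R) :
    Ideal R :=
  Ideal.span {d : R | ∃ (r : Fin j ↪o Fin m) (c : Fin j ↪o Fin n), d = (X.submatrix r c).det}

/-- The matrix `X + yA` over `S[y]`, where `X` is a matrix over the `K`-algebra `S`,
`A` is a matrix over `K`, and `y = Polynomial.X`. -/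
noncomputable def addVarMul {K S : Type*} [CommRing K] [CommRing S] [Algebra K S] {m n : ℕ}
    (X : Matrix (Fin m) (Fin n) S) (A : Matrix (Fin m) (Fin n) K) :
    Matrix (Fin m) (Fin n) (Polynomial S) :=
  X.map (algebraMap S (Polynomial S)) +
    (Polynomial.X : Polynomial S) • A.map (algebraMap K (Polynomial S))

/-! Setting `y = 0` turns `X + yA` into `X`, and the primes of `S[y]` containing `y` are the `p +
(y)`, of height `ht p + 1`. This bounds `ht I_j(X + yA)` above by `ht I_j(X) + 1`, and shows that a
prime over `I_j(X + yA)` containing `y` has height at least `ht I_j(X) + 1`. For the lower bound in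
(1), `X + yA` again has linear entries, so a minimal prime `Q` of `I_j(X + yA)` lies in the
irrelevant ideal and `Q + (y)` is proper; by the dimension formula a minimal prime over it has
height at most `ht Q + 1`, and it contains `y`.

For (2), only primes avoiding `y` remain. Once `y` is inverted, `X + yA` is `y` times the translate
`y⁻¹X + A`, and for suitable `A` every prime over the `j`-minors of the translate has height at
least `(m+1-j)(n+1-j)` (`exists_translate_minorsIdeal_height_le`, by adding rows one at a time).
That number is also an upper bound for matrices of linear forms: near a point of rank exactly `j -
1`, the bordered minors of one nonzero minor cut out the locus, and Krull's height theorem applies.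
-/

/-! ### Ideals of minors -/

theorem Matrix.det_submatrix_mem_minorsIdeal {R : Type*} [CommRing R] {m n j : ℕ}
    (X : Matrix (Fin m) (Fin n) R) (f : Fin j → Fin m) (g : Fin j → Fin n) :
    (X.submatrix f g).det ∈ minorsIdeal j X := by
  have key : ∀ {l : ℕ} (h : Fin j → Fin l), Function.Injective h →
      ∃ (e : Fin j ↪o Fin l) (s : Equiv.Perm (Fin j)), h = e ∘ s := by
    intro l h hh
    have hs : StrictMono (h ∘ Tuple.sort h) :=
      (Tuple.monotone_sort h).strictMono_of_injective (hh.comp (Equiv.injective _))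
    refine ⟨OrderEmbedding.ofStrictMono _ hs, (Tuple.sort h)⁻¹, ?_⟩
    ext x
    simp
  by_cases hf : Function.Injective f
  · by_cases hg : Function.Injective g
    · obtain ⟨e, s, rfl⟩ := key f hf
      obtain ⟨e', s', rfl⟩ := key g hg
      have : X.submatrix (e ∘ s) (e' ∘ s') =
          ((X.submatrix e e').submatrix s id).submatrix id s' := rfl
      rw [this, Matrix.det_permute', Matrix.det_permute]
      exact Ideal.mul_mem_left _ _ (Ideal.mul_mem_left _ _ (Ideal.subset_span ⟨e, e', rfl⟩))
    · obtain ⟨a, b, hab, hne⟩ := Function.not_injective_iff.mp hg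
      rw [Matrix.det_zero_of_column_eq hne (by intro i; simp [hab])]
      exact zero_mem _
  · obtain ⟨a, b, hab, hne⟩ := Function.not_injective_iff.mp hf
    rw [Matrix.det_zero_of_row_eq hne (by ext i; simp [hab])]
    exact zero_mem _

theorem minorsIdeal_le_iff {R : Type*} [CommRing R] {m n j : ℕ}
    {X : Matrix (Fin m) (Fin n) R} {I : Ideal R} :
    minorsIdeal j X ≤ I ↔
      ∀ (f : Fin j → Fin m) (g : Fin j → Fin n), (X.submatrix f g).det ∈ I := by
  refine ⟨fun h f g ↦ h (X.det_submatrix_mem_minorsIdeal f g), fun h ↦ ?_⟩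
  rw [minorsIdeal, Ideal.span_le]
  rintro _ ⟨r, c, rfl⟩
  exact h r c

theorem minorsIdeal_zero {R : Type*} [CommRing R] {m n : ℕ} (X : Matrix (Fin m) (Fin n) R) :
    minorsIdeal 0 X = ⊤ := by
  rw [Ideal.eq_top_iff_one]
  simpa using X.det_submatrix_mem_minorsIdeal (j := 0) Fin.elim0 Fin.elim0

theorem map_minorsIdeal {R S : Type*} [CommRing R] [CommRing S] (f : R →+* S) {m n : ℕ} (j : ℕ)
    (X : Matrix (Fin m) (Fin n) R) :
    (minorsIdeal j X).map f = minorsIdeal j (X.map f) := by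
  have hdet : ∀ (r : Fin j → Fin m) (c : Fin j → Fin n),
      ((X.map f).submatrix r c).det = f (X.submatrix r c).det := fun r c ↦ by
    rw [RingHom.map_det]; rfl
  refine le_antisymm ?_ ?_
  · rw [Ideal.map_le_iff_le_comap, minorsIdeal_le_iff]
    intro r c
    rw [Ideal.mem_comap, ← hdet]
    exact Matrix.det_submatrix_mem_minorsIdeal _ _ _
  · rw [minorsIdeal_le_iff]
    intro r c
    rw [hdet]
    exact Ideal.mem_map_of_mem _ (Matrix.det_submatrix_mem_minorsIdeal _ _ _)

/-- Padding both factors with zeros makes them square, one with a zero column. -/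
theorem Matrix.det_mul_eq_zero_of_lt {R : Type*} [CommRing R] {j l : ℕ} (hl : l < j)
    (E : Matrix (Fin j) (Fin l) R) (F : Matrix (Fin l) (Fin j) R) : (E * F).det = 0 := by
  obtain ⟨d, rfl⟩ : ∃ d, j = l + (d + 1) := ⟨j - l - 1, by omega⟩
  let E' := (Matrix.fromCols E (0 : Matrix _ (Fin (d + 1)) R)).submatrix id finSumFinEquiv.symm
  let F' := (Matrix.fromRows F (0 : Matrix (Fin (d + 1)) _ R)).submatrix finSumFinEquiv.symm id
  have h : E * F = E' * F' := by
    rw [Matrix.submatrix_mul_equiv, Matrix.fromCols_mul_fromRows]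
    simp
  rw [h, Matrix.det_mul, Matrix.det_eq_zero_of_column_eq_zero (Fin.natAdd l 0), zero_mul]
  intro i
  simp [E']

theorem minorsIdeal_mul_eq_bot {R : Type*} [CommRing R] {m n j l : ℕ} (hl : l < j)
    (E : Matrix (Fin m) (Fin l) R) (F : Matrix (Fin l) (Fin n) R) :
    minorsIdeal j (E * F) = ⊥ := by
  rw [← le_bot_iff, minorsIdeal_le_iff]
  intro f g
  have : (E * F).submatrix f g = E.submatrix f id * F.submatrix id g := rfl
  rw [this, Matrix.det_mul_eq_zero_of_lt hl]
  exact zero_mem _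

/-! ### Generic translates: lower bounds for heights -/

section GenericTranslate

variable {K : Type*} [Field K] {S : Type*} [CommRing S] [Algebra K S]

/-- Two such scalars differ by a unit, which would force `d` into `Q`. -/
theorem subsingleton_setOf_mul_add_mem {Q : Ideal S} [Q.IsPrime] {d : S} (hd : d ∉ Q) (x u : S) :
    {c : K | d * (x + algebraMap K S c) + u ∈ Q}.Subsingleton := by
  intro c hc c' hc'
  by_contra hne
  have h : d * algebraMap K S (c - c') ∈ Q := by
    have := Q.sub_mem hc hc'
    convert this using 1
    rw [map_sub]; ring
  rcases Ideal.IsPrime.mem_or_mem ‹_› h with h | h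
  · exact hd h
  · exact Ideal.IsPrime.ne_top ‹_› (Ideal.eq_top_of_isUnit_mem _ h
      ((IsUnit.mk0 _ (sub_ne_zero.mpr hne)).map _))

/-- A triangular system of elements `δ i * r k + u i k r`, where `u i k r` only involves the
entries `r l` with `l < k`, becomes a sequence of parameters away from `δ i` after translating
`r` by suitable scalars. -/
theorem exists_translate_height_add_card_le [Infinite K] [IsNoetherianRing S]
    {ι : Type*} [Finite ι] {n : ℕ} (x : Fin n → S) (J : ι → Ideal S) (δ : ι → S) (T : ι → Finset (Fin n))
    (u : ι → Fin n → (Fin n → S) → S)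
    (hu : ∀ i k r r', (∀ l < k, r l = r' l) → u i k r = u i k r') :
    ∃ a : Fin n → K, ∀ i, ∀ P : Ideal S, P.IsPrime → J i ≤ P → δ i ∉ P →
      (∀ k ∈ T i, δ i * (x k + algebraMap K S (a k)) +
        u i k (fun l ↦ x l + algebraMap K S (a l)) ∈ P) →
      (J i).height + ((T i).card : ℕ∞) ≤ P.height := by
  classical
  let r : (Fin n → K) → Fin n → S := fun a l ↦ x l + algebraMap K S (a l)
  let D : ι → Fin n → (Fin n → S) → S := fun i k r ↦ δ i * r k + u i k r
  let J' : ι → ℕ → (Fin n → S) → Ideal S := fun i k r ↦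
    J i ⊔ Ideal.span {d | ∃ l ∈ T i, l.val < k ∧ d = D i l r}
  have hD : ∀ i k r r', (∀ l ≤ k, r l = r' l) → D i k r = D i k r' := fun i k r r' h ↦ by
    simp only [D]
    rw [h k le_rfl, hu i k r r' fun l hl ↦ h l hl.le]
  have hJ' : ∀ i k r r', (∀ l : Fin n, l.val < k → r l = r' l) → J' i k r = J' i k r' := by
    intro i k r r' h
    simp only [J']
    congr 2
    ext d
    refine exists_congr fun l ↦ and_congr_right fun _ ↦ and_congr_right fun hl ↦ ?_
    rw [hD i l r r' fun l' hl' ↦ h l' (lt_of_le_of_lt hl' hl)]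
  -- The scalars are chosen one coordinate at a time. `J' i k` sees only the coordinates below `k`,
  -- so later choices leave earlier conditions intact.
  have avoid : ∀ N ≤ n, ∃ a : Fin n → K, ∀ i, ∀ k : Fin n, k.val < N →
      ∀ Q ∈ (J' i k (r a)).minimalPrimes, δ i ∉ Q → D i k (r a) ∉ Q := by
    intro N
    induction N with
    | zero => exact fun _ ↦ ⟨0, fun i k hk ↦ absurd hk (Nat.not_lt_zero _)⟩
    | succ N ih =>
      intro hN
      obtain ⟨a, ha⟩ := ih (by omega)
      let k₀ : Fin n := ⟨N, hN⟩
      -- Each of the finitely many minimal primes rules out at most one scalar, and `K` is infinite.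
      have hfin : (⋃ i, ⋃ Q ∈ (J' i N (r a)).minimalPrimes, {c : K | δ i ∉ Q ∧
          δ i * (x k₀ + algebraMap K S c) + u i k₀ (r a) ∈ Q}).Finite := by
        refine Set.finite_iUnion fun i ↦
          Set.Finite.biUnion (Ideal.finite_minimalPrimes_of_isNoetherianRing S _) fun Q hQ ↦ ?_
        have := hQ.1.1
        refine Set.Subsingleton.finite fun c hc c' hc' ↦ ?_
        exact subsingleton_setOf_mul_add_mem hc.1 _ _ hc.2 hc'.2
      obtain ⟨c, hc⟩ := hfin.exists_notMem
      have hr : ∀ l : Fin n, l.val < N → r (Function.update a k₀ c) l = r a l := fun l hl ↦ by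
        have : l ≠ k₀ := fun h ↦ by simp [h, k₀] at hl
        simp [r, this]
      refine ⟨Function.update a k₀ c, fun i k hk Q hQ hδ ↦ ?_⟩
      rw [hJ' i k _ (r a) fun l hl ↦ hr l (by omega)] at hQ
      rcases Nat.lt_succ_iff_lt_or_eq.mp hk with hk | hk
      · rw [hD i k _ (r a) fun l hl ↦ hr l (lt_of_le_of_lt hl hk)]
        exact ha i k hk Q hQ hδ
      · obtain rfl : k = k₀ := Fin.ext hk
        intro hmem
        simp only [D] at hmem
        rw [hu i k₀ _ (r a) fun l hl ↦ hr l hl] at hmem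
        refine hc (Set.mem_iUnion.mpr ⟨i, Set.mem_iUnion₂.mpr ⟨Q, hQ, hδ, ?_⟩⟩)
        simpa [r] using hmem
  obtain ⟨a, ha⟩ := avoid n le_rfl
  refine ⟨a, fun i P hP hJP hδ hDP ↦ ?_⟩
  have main : ∀ N ≤ n, ∀ Q : Ideal S, Q.IsPrime → J' i N (r a) ≤ Q → δ i ∉ Q →
      (J i).height + (((T i).filter fun l ↦ l.val < N).card : ℕ∞) ≤ Q.height := by
    intro N
    induction N with
    | zero =>
      intro _ Q _ hQ _
      simpa using Ideal.height_mono (le_sup_left.trans hQ)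
    | succ N ih =>
      intro hN Q hQp hQ hδQ
      have hle : J' i N (r a) ≤ J' i (N + 1) (r a) :=
        sup_le_sup_left (Ideal.span_mono (by
          rintro d ⟨l, hl, hlN, hd⟩
          exact ⟨l, hl, by omega, hd⟩)) _
      let k₀ : Fin n := ⟨N, hN⟩
      by_cases hk : k₀ ∈ T i
      · obtain ⟨Q', hQ', hQQ'⟩ := Ideal.exists_minimalPrimes_le (hle.trans hQ)
        have := hQ'.1.1
        have hδ' : δ i ∉ Q' := fun h ↦ hδQ (hQQ' h)
        have hDQ : D i k₀ (r a) ∈ Q :=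
          hQ (Ideal.mem_sup_right (Ideal.subset_span ⟨k₀, hk, Nat.lt_succ_self N, rfl⟩))
        -- The new equation lies in `Q` but not in `Q'`, so the height strictly grows.
        have hlt : Q' < Q := lt_of_le_of_ne hQQ' fun h ↦
          ha i k₀ hN Q' hQ' hδ' (h ▸ hDQ)
        have hfil : (T i).filter (fun l ↦ l.val < N + 1) =
            insert k₀ ((T i).filter fun l ↦ l.val < N) := by
          ext l
          simp only [Finset.mem_filter, Finset.mem_insert, Fin.ext_iff, k₀]
          constructor
          · rintro ⟨h1, h2⟩
            by_cases h : l.val = N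
            · exact Or.inl h
            · exact Or.inr ⟨h1, by omega⟩
          · rintro (h | ⟨h1, h2⟩)
            · exact ⟨by rwa [show l = k₀ from Fin.ext h], by omega⟩
            · exact ⟨h1, by omega⟩
        rw [hfil, Finset.card_insert_of_notMem (by simp [k₀]), Nat.cast_add, Nat.cast_one,
          ← add_assoc]
        exact (add_le_add_left (ih (by omega) Q' this hQ'.1.2 hδ') 1).trans
          (Ideal.height_add_one_le_of_lt_of_isPrime hlt)
      · have hfil : (T i).filter (fun l ↦ l.val < N + 1) = (T i).filter fun l ↦ l.val < N := by
          refine Finset.filter_congr fun l hl ↦ ?_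
          have : l.val ≠ N := fun h ↦ hk (by rwa [← show l = k₀ from Fin.ext h])
          omega
        rw [hfil]
        exact ih (by omega) Q hQp (hle.trans hQ) hδQ
  have := main n le_rfl P hP (sup_le hJP (Ideal.span_le.mpr ?_)) hδ
  · simpa using this
  · rintro _ ⟨l, hl, -, rfl⟩
    exact hDP l hl

/-- Minimality of the column sum is what makes the equations in `exists_row_height_le` triangular.
-/
theorem exists_minor_notMem_of_not_le {m n j : ℕ} {Y : Matrix (Fin m) (Fin n) S} {P : Ideal S}
    (h : ¬ minorsIdeal j Y ≤ P) :
    ∃ (R : Fin j → Fin m) (C : Fin j → Fin n), (Y.submatrix R C).det ∉ P ∧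
      ∀ C' : Fin j → Fin n, ∑ l, (C' l).val < ∑ l, (C l).val → (Y.submatrix R C').det ∈ P := by
  rw [minorsIdeal_le_iff] at h
  push Not at h
  obtain ⟨R, hR⟩ := h
  obtain ⟨C, hC, hmin⟩ := WellFounded.has_min
    (InvImage.wf (fun C : Fin j → Fin n ↦ ∑ l, (C l).val) Nat.lt_wfRel.wf)
    {C | (Y.submatrix R C).det ∉ P} hR
  exact ⟨R, C, hC, fun C' hC' ↦ by_contra fun h ↦ hmin C' h hC'⟩

/-- If some `j`-minor `δ` of `Y` is outside `P`, bordering it by the new row and each of the `n - j`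
unused columns gives equations `δ * r k + ⋯ ∈ P`, which add `n - j` to the height `(m - j)(n - j)`
coming from `Y`. Otherwise `P` contains the `j`-minors of `Y`, and the bound for `Y` one size lower
suffices. -/
theorem exists_row_height_le [Infinite K] [IsNoetherianRing S] {m n : ℕ}
    (Y : Matrix (Fin m) (Fin n) S)
    (hY : ∀ j, ∀ P : Ideal S, P.IsPrime → minorsIdeal (j + 1) Y ≤ P →
      (((m - j) * (n - j) : ℕ) : ℕ∞) ≤ P.height) (x : Fin n → S) :
    ∃ a : Fin n → K, ∀ j, ∀ P : Ideal S, P.IsPrime →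
      minorsIdeal (j + 1) (Matrix.of (Fin.cons (fun k ↦ x k + algebraMap K S (a k)) Y :
        Fin (m + 1) → Fin n → S)) ≤ P →
      (((m + 1 - j) * (n - j) : ℕ) : ℕ∞) ≤ P.height := by
  classical
  -- All minor sizes and positions form one finite index set, so a single `a` serves them all.
  let ι := Σ j : Fin (n + 1), (Fin j.val → Fin m) × (Fin j.val → Fin n)
  obtain ⟨a, ha⟩ := exists_translate_height_add_card_le (K := K) (ι := ι) x
    (fun i ↦ minorsIdeal (i.1 + 1) Y) (fun i ↦ (Y.submatrix i.2.1 i.2.2).det)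
    (fun i ↦ (Finset.univ.image i.2.2)ᶜ)
    (fun i k r ↦ ∑ l, if i.2.2 l < k then (-1) ^ (l.succ : ℕ) * r (i.2.2 l) *
      (Y.submatrix i.2.1 ((Fin.cons k i.2.2 : Fin (i.1 + 1) → Fin n) ∘ l.succ.succAbove)).det
      else 0)
    (by
      intro i k r r' h
      refine Finset.sum_congr rfl fun l _ ↦ ?_
      split_ifs with hl
      · rw [h _ hl]
      · rfl)
  refine ⟨a, fun j P hP hle ↦ ?_⟩
  set r : Fin n → S := fun k ↦ x k + algebraMap K S (a k)
  by_cases hj : minorsIdeal j Y ≤ P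
  · obtain _ | j := j
    · rw [minorsIdeal_zero, top_le_iff] at hj
      exact absurd hj hP.ne_top
    · refine le_trans ?_ (hY j P hP hj)
      exact_mod_cast Nat.mul_le_mul (by omega) (by omega)
  by_cases hjn : n < j
  · simp [Nat.sub_eq_zero_of_le hjn.le]
  by_cases hjm : m < j
  · simp [Nat.sub_eq_zero_of_le (Nat.succ_le_of_lt hjm)]
  obtain ⟨R, C, hδ, hmin⟩ := exists_minor_notMem_of_not_le hj
  have hYP : minorsIdeal (j + 1) Y ≤ P := by
    rw [minorsIdeal_le_iff]
    intro f g
    exact minorsIdeal_le_iff.mp hle (Fin.succ ∘ f) g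
  have hht := ha ⟨⟨j, by omega⟩, R, C⟩ P hP hYP hδ (by
    intro k hk
    have hkC : ∀ l, C l ≠ k := by simpa using hk
    have hdet := minorsIdeal_le_iff.mp hle (Fin.cons 0 (Fin.succ ∘ R)) (Fin.cons k C)
    rw [Matrix.det_succ_row_zero, Fin.sum_univ_succ] at hdet
    have h0 : (Matrix.submatrix (Matrix.of (Fin.cons r Y : Fin (m + 1) → Fin n → S))
        (Fin.cons 0 (Fin.succ ∘ R) : Fin (j + 1) → Fin (m + 1))
        (Fin.cons k C : Fin (j + 1) → Fin n)).submatrix Fin.succ (Fin.succAbove 0) =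
        Y.submatrix R C := by
      ext p q; rfl
    rw [h0] at hdet
    have h1 : ∀ l : Fin j, (Matrix.submatrix (Matrix.of (Fin.cons r Y : Fin (m + 1) → Fin n → S))
        (Fin.cons 0 (Fin.succ ∘ R) : Fin (j + 1) → Fin (m + 1))
        (Fin.cons k C : Fin (j + 1) → Fin n)).submatrix Fin.succ l.succ.succAbove =
        Y.submatrix R ((Fin.cons k C : Fin (j + 1) → Fin n) ∘ l.succ.succAbove) := by
      intro l; ext p q; rfl
    simp only [h1] at hdet
    simp only [Fin.val_zero, pow_zero, one_mul, Matrix.submatrix_apply, Fin.cons_zero,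
      Matrix.of_apply, Fin.cons_succ] at hdet
    -- The terms with `C l > k` break triangularity, but they lie in `P`: replacing column `C l` by
    -- `k` lowers the column sum.
    rw [← Ideal.add_mem_iff_left (b := ∑ l : Fin j, if C l < k then 0 else
      (-1) ^ (l.succ : ℕ) * r (C l) *
      (Y.submatrix R ((Fin.cons k C : Fin (j + 1) → Fin n) ∘ l.succ.succAbove)).det)]
    · rw [add_assoc, ← Finset.sum_add_distrib]
      convert hdet using 2
      · exact mul_comm _ _
      · refine Finset.sum_congr rfl fun l _ ↦ ?_
        split_ifs
        · exact add_zero _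
        · exact zero_add _
    · refine Ideal.sum_mem _ fun l _ ↦ ?_
      split_ifs with hl
      · exact zero_mem _
      · refine Ideal.mul_mem_left _ _ (hmin _ ?_)
        have hsum : ∑ p, ((Fin.cons k C : Fin (j + 1) → Fin n) p).val =
            (C l).val + ∑ p, (((Fin.cons k C : Fin (j + 1) → Fin n) ∘ l.succ.succAbove) p).val := by
          rw [Fin.sum_univ_succAbove _ l.succ]; simp
        rw [Fin.sum_univ_succ] at hsum
        simp only [Fin.cons_zero, Fin.cons_succ] at hsum
        have : k.val < (C l).val := lt_of_le_of_ne (not_lt.mp hl) fun h ↦ hkC l (Fin.ext h.symm)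
        omega)
  have hcard : n - j ≤ ((Finset.univ.image C)ᶜ).card := by
    rw [Finset.card_compl, Fintype.card_fin]
    have := Finset.card_image_le (s := Finset.univ) (f := C)
    simp only [Finset.card_univ, Fintype.card_fin] at this
    omega
  have hJ : (((m - j) * (n - j) : ℕ) : ℕ∞) ≤ (minorsIdeal (j + 1) Y).height := by
    rw [Ideal.height_eq_inf_minimalPrimes]
    exact le_iInf₂ fun Q hQ ↦ hY j Q hQ.1.1 hQ.1.2
  refine le_trans ?_ (le_trans (add_le_add hJ (Nat.cast_le.mpr hcard)) hht)
  rw [← Nat.cast_add, Nat.cast_le]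
  rw [Nat.succ_sub (by omega), Nat.succ_mul]

variable (K) in
/-- Translating a matrix by a suitable scalar matrix, all of its determinantal ideals attain at
least the generic height. -/
theorem exists_translate_minorsIdeal_height_le [Infinite K] [IsNoetherianRing S] {m n : ℕ}
    (X : Matrix (Fin m) (Fin n) S) :
    ∃ A : Matrix (Fin m) (Fin n) K, ∀ j, ∀ P : Ideal S, P.IsPrime →
      minorsIdeal (j + 1) (X + A.map (algebraMap K S)) ≤ P →
      (((m - j) * (n - j) : ℕ) : ℕ∞) ≤ P.height := by
  induction m with
  | zero => exact ⟨0, fun j P _ _ ↦ by simp⟩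
  | succ m ih =>
    obtain ⟨A, hA⟩ := ih (X.submatrix Fin.succ id)
    obtain ⟨a, ha⟩ := exists_row_height_le (K := K) _ hA (X 0)
    refine ⟨Matrix.of (Fin.cons a A : Fin (m + 1) → Fin n → K), fun j P hP hle ↦ ha j P hP ?_⟩
    convert hle using 2
    ext i k
    refine Fin.cases ?_ (fun i ↦ ?_) i <;> rfl

end GenericTranslate

/-! ### Bordered minors: upper bounds for heights -/

/-- If all bordered minors of a minor outside a prime `Q` lie in `Q`, then so do all minors of the
next size. -/
theorem minorsIdeal_le_of_bordered_mem {R : Type*} [CommRing R] {m n j : ℕ}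
    {Y : Matrix (Fin m) (Fin n) R} {Q : Ideal R} [Q.IsPrime] {r : Fin j → Fin m} {c : Fin j → Fin n}
    (hδ : (Y.submatrix r c).det ∉ Q)
    (h : ∀ i k, (Y.submatrix (Fin.cons i r : Fin (j + 1) → Fin m)
      (Fin.cons k c : Fin (j + 1) → Fin n)).det ∈ Q) :
    minorsIdeal (j + 1) Y ≤ Q := by
  let f := Ideal.Quotient.mk Q
  let δ := (Y.submatrix r c).det
  -- Expanding the vanishing bordered minors along their first column writes `δ • Y` modulo `Q` as a
  -- product through `j` dimensions, so its `(j + 1)`-minors vanish.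
  let E : Matrix (Fin m) (Fin j) (R ⧸ Q) := Matrix.of fun i l ↦
    f (-((-1) ^ (l.succ : ℕ) *
      (Y.submatrix ((Fin.cons i r : Fin (j + 1) → Fin m) ∘ l.succ.succAbove) c).det))
  let F : Matrix (Fin j) (Fin n) (R ⧸ Q) := (Y.submatrix r id).map f
  have hEF : E * F = f δ • Y.map f := by
    ext i k
    have hik := h i k
    rw [Matrix.det_succ_column_zero, Fin.sum_univ_succ, ← Ideal.Quotient.eq_zero_iff_mem, map_add,
      map_sum] at hik
    rw [Matrix.mul_apply, Matrix.smul_apply, Matrix.map_apply, smul_eq_mul]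
    have h0 : f δ * f (Y i k) = Ideal.Quotient.mk Q ((-1) ^ ((0 : Fin (j + 1)) : ℕ) *
        (Y.submatrix (Fin.cons i r : Fin (j + 1) → Fin m) (Fin.cons k c : Fin (j + 1) → Fin n)) 0 0 *
        ((Y.submatrix (Fin.cons i r : Fin (j + 1) → Fin m)
          (Fin.cons k c : Fin (j + 1) → Fin n)).submatrix (Fin.succAbove 0) Fin.succ).det) := by
      rw [← map_mul, Fin.val_zero, pow_zero, one_mul, mul_comm]
      rfl
    rw [h0, eq_neg_of_add_eq_zero_left hik, ← Finset.sum_neg_distrib]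
    refine Finset.sum_congr rfl fun l _ ↦ ?_
    simp only [E, F, Matrix.of_apply, Matrix.map_apply, Matrix.submatrix_apply, Fin.cons_succ,
      Fin.cons_zero, id, Matrix.submatrix_submatrix]
    rw [← map_neg, ← map_mul]
    congr 1
    have : (Fin.cons k c : Fin (j + 1) → Fin n) ∘ Fin.succ = c := rfl
    rw [this]
    ring
  rw [minorsIdeal_le_iff]
  intro p q
  have hz : ((f δ • Y.map f).submatrix p q).det = 0 := by
    have := minorsIdeal_mul_eq_bot (Nat.lt_succ_self j) E F
    rw [hEF] at this
    simpa [this] using (f δ • Y.map f).det_submatrix_mem_minorsIdeal p q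
  have hs : (f δ • Y.map f).submatrix p q = f δ • f.mapMatrix (Y.submatrix p q) := rfl
  rw [hs, Matrix.det_smul, ← RingHom.map_det] at hz
  rcases mul_eq_zero.mp hz with hz | hz
  · exact absurd (Ideal.Quotient.eq_zero_iff_mem.mp (pow_eq_zero_iff (by simp) |>.mp hz)) hδ
  · exact Ideal.Quotient.eq_zero_iff_mem.mp hz

/-- `P` is already minimal over the bordered minors of `δ`; those repeating a row or column vanish,
leaving at most `(m - j)(n - j)` generators for Krull's height theorem. -/
theorem height_le_of_mem_minimalPrimes_minorsIdeal {R : Type*} [CommRing R] [IsNoetherianRing R]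
    {m n j : ℕ} {Y : Matrix (Fin m) (Fin n) R} {P : Ideal R}
    (hP : P ∈ (minorsIdeal (j + 1) Y).minimalPrimes) {r : Fin j → Fin m} {c : Fin j → Fin n}
    (hδ : (Y.submatrix r c).det ∉ P) :
    P.height ≤ (((m - j) * (n - j) : ℕ) : ℕ∞) := by
  classical
  have hr : Function.Injective r := by
    by_contra hr
    obtain ⟨a, b, hab, hne⟩ := Function.not_injective_iff.mp hr
    rw [Matrix.det_zero_of_row_eq hne (by ext i; simp [hab])] at hδ
    exact hδ (zero_mem _)
  have hc : Function.Injective c := by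
    by_contra hc
    obtain ⟨a, b, hab, hne⟩ := Function.not_injective_iff.mp hc
    rw [Matrix.det_zero_of_column_eq hne (by intro i; simp [hab])] at hδ
    exact hδ (zero_mem _)
  let s : Finset R := ((Finset.univ.image r)ᶜ ×ˢ (Finset.univ.image c)ᶜ).image fun p ↦
    (Y.submatrix (Fin.cons p.1 r : Fin (j + 1) → Fin m)
      (Fin.cons p.2 c : Fin (j + 1) → Fin n)).det
  have hs : s.card ≤ (m - j) * (n - j) := by
    refine Finset.card_image_le.trans ?_
    rw [Finset.card_product, Finset.card_compl, Finset.card_compl,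
      Finset.card_image_of_injective _ hr, Finset.card_image_of_injective _ hc]
    simp
  refine le_trans (Ideal.height_le_card_of_mem_minimalPrimes_span_finset (s := s) ?_)
    (Nat.cast_le.mpr hs)
  refine ⟨⟨hP.1.1, ?_⟩, ?_⟩
  · refine le_trans (Ideal.span_le.mpr ?_) hP.1.2
    intro d hd
    obtain ⟨p, -, rfl⟩ := Finset.mem_image.mp hd
    exact Matrix.det_submatrix_mem_minorsIdeal _ _ _
  · rintro Q ⟨hQ, hsQ⟩ hQP
    refine hP.2 ⟨hQ, minorsIdeal_le_of_bordered_mem (fun h ↦ hδ (hQP h)) fun i k ↦ ?_⟩ hQP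
    by_cases hi : ∃ l, r l = i
    · obtain ⟨l, rfl⟩ := hi
      rw [Matrix.det_zero_of_row_eq (Fin.succ_ne_zero l) (by ext; simp)]
      exact zero_mem _
    by_cases hk : ∃ l, c l = k
    · obtain ⟨l, rfl⟩ := hk
      rw [Matrix.det_zero_of_column_eq (Fin.succ_ne_zero l) (by intro; simp)]
      exact zero_mem _
    exact hsQ (Ideal.subset_span (Finset.mem_image.mpr ⟨(i, k), by simp_all, rfl⟩))

/-! ### Dimension theory of domains of finite type -/

section Dimension

open Order

/-- Incomparability with going-down preserves heights; with going-up, coheights. -/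
theorem PrimeSpectrum.height_eq_and_coheight_eq_of_isIntegral {A B : Type*} [CommRing A]
    [CommRing B] [IsDomain B] [Algebra A B] [FaithfulSMul A B] [Algebra.IsIntegral A B]
    [IsIntegrallyClosed A] (Q : PrimeSpectrum B) :
    height Q = height (comap (algebraMap A B) Q) ∧
      coheight Q = coheight (comap (algebraMap A B) Q) := by
  have hmono : StrictMono (comap (algebraMap A B)) := fun P Q h ↦
    Ideal.IsIntegral.comap_lt_comap (R := A) (I := P.asIdeal) (J := Q.asIdeal) h
  constructor
  · refine height_eq_of_strictMono _ hmono (fun Q p hp ↦ ?_) Q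
    have : Q.asIdeal.LiesOver (comap (algebraMap A B) Q).asIdeal := ⟨rfl⟩
    obtain ⟨P, hPQ, hP, ⟨hPp⟩⟩ := Ideal.exists_ideal_lt_liesOver_of_lt (p := p.asIdeal)
      (q := (comap (algebraMap A B) Q).asIdeal) Q.asIdeal hp
    exact ⟨⟨P, hP⟩, hPQ, PrimeSpectrum.ext hPp.symm⟩
  · refine coheight_eq_of_strictMono _ hmono (fun Q p hp ↦ ?_) Q
    have : Q.asIdeal.LiesOver (comap (algebraMap A B) Q).asIdeal := ⟨rfl⟩
    obtain ⟨P, hPQ, hP, ⟨hPp⟩⟩ := Ideal.exists_ideal_gt_liesOver_of_lt (q := p.asIdeal)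
      (p := (comap (algebraMap A B) Q).asIdeal) Q.asIdeal hp
    exact ⟨⟨P, hP⟩, hPQ, PrimeSpectrum.ext hPp.symm⟩

theorem PrimeSpectrum.comap_mk_lt_comap_mk_iff {R : Type*} [CommRing R] {I : Ideal R}
    {P Q : PrimeSpectrum (R ⧸ I)} :
    comap (Ideal.Quotient.mk I) P < comap (Ideal.Quotient.mk I) Q ↔ P < Q := by
  have hle : ∀ P Q : PrimeSpectrum (R ⧸ I),
      comap (Ideal.Quotient.mk I) P ≤ comap (Ideal.Quotient.mk I) Q ↔ P ≤ Q := fun P Q ↦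
    Ideal.comap_le_comap_iff_of_surjective _ Ideal.Quotient.mk_surjective P.asIdeal Q.asIdeal
  rw [lt_iff_le_not_ge, lt_iff_le_not_ge, hle, hle]

theorem PrimeSpectrum.strictMono_comap_mk {R : Type*} [CommRing R] (I : Ideal R) :
    StrictMono (comap (Ideal.Quotient.mk I)) :=
  fun _ _ h ↦ comap_mk_lt_comap_mk_iff.mpr h

theorem PrimeSpectrum.exists_comap_mk_eq {R : Type*} [CommRing R] {I : Ideal R}
    (P : PrimeSpectrum R) (h : I ≤ P.asIdeal) :
    ∃ P' : PrimeSpectrum (R ⧸ I), comap (Ideal.Quotient.mk I) P' = P := by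
  have : P ∈ Set.range (comap (Ideal.Quotient.mk I)) := by
    rw [range_comap_of_surjective _ _ Ideal.Quotient.mk_surjective]
    simpa [mem_zeroLocus] using h
  exact this

theorem PrimeSpectrum.coheight_comap_mk {R : Type*} [CommRing R] (I : Ideal R)
    (Q : PrimeSpectrum (R ⧸ I)) : coheight Q = coheight (comap (Ideal.Quotient.mk I) Q) := by
  refine coheight_eq_of_strictMono _ (strictMono_comap_mk I) (fun Q p hp ↦ ?_) Q
  obtain ⟨P', rfl⟩ := exists_comap_mk_eq (I := I) p (le_trans (by
    intro x hx
    simp [Ideal.Quotient.eq_zero_iff_mem.mpr hx]) hp.le)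
  exact ⟨P', comap_mk_lt_comap_mk_iff.mp hp, rfl⟩

theorem PrimeSpectrum.height_add_one_le_height_comap_mk {R : Type*} [CommRing R] [IsDomain R]
    {I : Ideal R} (hI : I ≠ ⊥) (Q : PrimeSpectrum (R ⧸ I)) :
    height Q + 1 ≤ height (comap (Ideal.Quotient.mk I) Q) := by
  -- A chain of primes over `I ≠ ⊥` extends downwards by the zero ideal.
  let g : WithBot (PrimeSpectrum (R ⧸ I)) → PrimeSpectrum R :=
    WithBot.recBotCoe ⊥ (comap (Ideal.Quotient.mk I))
  have hg : StrictMono g := by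
    intro a b hab
    induction b with
    | bot => simp at hab
    | coe b =>
      induction a with
      | bot =>
        refine bot_lt_iff_ne_bot.mpr fun h ↦ hI ?_
        rw [← le_bot_iff]
        intro x hx
        have hx' : x ∈ (comap (Ideal.Quotient.mk I) b).asIdeal := by
          simp [Ideal.Quotient.eq_zero_iff_mem.mpr hx]
        rw [show comap (Ideal.Quotient.mk I) b = ⊥ from h] at hx'
        exact hx'
      | coe a => exact strictMono_comap_mk I (WithBot.coe_lt_coe.mp hab)
  rw [← height_coe_withBot]
  exact height_le_height_apply_of_strictMono g hg Q

theorem Order.height_add_coheight_le_krullDim {α : Type*} [Preorder α] (a : α) :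
    ((height a + coheight a : ℕ∞) : WithBot ℕ∞) ≤ krullDim α := by
  have : Nonempty α := ⟨a⟩
  rw [krullDim_eq_iSup_height_add_coheight_of_nonempty, WithBot.coe_le_coe]
  exact le_iSup (fun a : α ↦ height a + coheight a) a

variable {K : Type*} [Field K]

theorem MvPolynomial.krullDim_primeSpectrum_fin (N : ℕ) :
    krullDim (PrimeSpectrum (MvPolynomial (Fin N) K)) = N := by
  have := MvPolynomial.ringKrullDim_of_isNoetherianRing (R := K) (ι := Fin N)
  rw [ringKrullDim_eq_zero_of_field, zero_add, Nat.card_fin] at this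
  exact this

theorem MvPolynomial.height_of_isMaximal_fin {N : ℕ} (M : Ideal (MvPolynomial (Fin N) K))
    [hM : M.IsMaximal] : M.height = N := by
  induction N with
  | zero =>
    have h := Ideal.height_le_ringKrullDim_of_isPrime (I := M)
    rw [MvPolynomial.ringKrullDim_of_isNoetherianRing, ringKrullDim_eq_zero_of_field] at h
    rw [Nat.card_fin] at h
    have : M.height ≤ 0 := by exact_mod_cast h
    simpa using this
  | succ N ih =>
    let e := (MvPolynomial.finSuccEquiv K N).toRingEquiv
    have hM' : (M.comap e.symm).IsMaximal := Ideal.comap_isMaximal_of_equiv e.symm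
    rw [← RingEquiv.height_comap e.symm M]
    have := Polynomial.isMaximal_comap_C_of_isJacobsonRing (M.comap e.symm)
    have hl : (M.comap e.symm).LiesOver ((M.comap e.symm).comap Polynomial.C) := ⟨rfl⟩
    rw [Polynomial.height_eq_height_add_one ((M.comap e.symm).comap Polynomial.C), ih]
    simp

-- Noether normalization: `φ` is contraction to a polynomial subring over which `B` is integral.
variable (K) in
theorem PrimeSpectrum.exists_height_eq_coheight_eq_fin (B : Type*) [CommRing B] [IsDomain B]
    [Algebra K B] [Algebra.FiniteType K B] :
    ∃ (s : ℕ) (φ : PrimeSpectrum B → PrimeSpectrum (MvPolynomial (Fin s) K)),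
      (∀ Q, height Q = height (φ Q) ∧ coheight Q = coheight (φ Q)) ∧
      coheight (⊥ : PrimeSpectrum B) = s := by
  obtain ⟨s, g, hg, hgi⟩ := exists_integral_inj_algHom_of_fg K B
  let _ : Algebra (MvPolynomial (Fin s) K) B := g.toRingHom.toAlgebra
  have : FaithfulSMul (MvPolynomial (Fin s) K) B :=
    (faithfulSMul_iff_algebraMap_injective _ _).mpr hg
  have : Algebra.IsIntegral (MvPolynomial (Fin s) K) B := ⟨hgi⟩
  refine ⟨s, comap (algebraMap _ _), height_eq_and_coheight_eq_of_isIntegral, ?_⟩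
  rw [(height_eq_and_coheight_eq_of_isIntegral (A := MvPolynomial (Fin s) K) _).2]
  have : comap (algebraMap (MvPolynomial (Fin s) K) B) ⊥ = ⊥ := by
    refine PrimeSpectrum.ext ?_
    exact Ideal.comap_bot_of_injective _ hg
  rw [this, ← WithBot.coe_inj, coheight_bot_eq_krullDim, MvPolynomial.krullDim_primeSpectrum_fin]
  rfl

/-- A nonzero prime contains a prime element `f`. The quotient by `f` has dimension `N - 1`, as
maximal ideals have height `N`, and normalizing it allows induction. -/
theorem MvPolynomial.le_height_add_coheight_fin (N : ℕ)
    (Q : PrimeSpectrum (MvPolynomial (Fin N) K)) : (N : ℕ∞) ≤ height Q + coheight Q := by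
  induction N using Nat.strong_induction_on with
  | _ N ih =>
    by_cases hQ : Q = ⊥
    · rw [hQ, ← WithBot.coe_le_coe, WithBot.coe_add, coheight_bot_eq_krullDim,
        krullDim_primeSpectrum_fin]
      simp
    · obtain ⟨f, hfQ, hf⟩ := Q.isPrime.exists_mem_prime_of_ne_bot
        (fun h ↦ hQ (PrimeSpectrum.ext h))
      let I := Ideal.span {f}
      have : I.IsPrime := (Ideal.span_singleton_prime hf.ne_zero).mpr hf
      have hI : I ≠ ⊥ := by simpa [I] using hf.ne_zero
      obtain ⟨s, φ, hφ, hs⟩ := PrimeSpectrum.exists_height_eq_coheight_eq_fin K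
        (MvPolynomial (Fin N) K ⧸ I)
      have hdim : ringKrullDim (MvPolynomial (Fin N) K ⧸ I) = s := by
        rw [ringKrullDim, ← coheight_bot_eq_krullDim, hs]; rfl
      have hlt : s < N := by
        have h := ringKrullDim_quotient_succ_le_of_nonZeroDivisor
          (mem_nonZeroDivisors_of_ne_zero hf.ne_zero)
        rw [hdim, ringKrullDim, krullDim_primeSpectrum_fin] at h
        exact_mod_cast h
      have hle : N ≤ s + 1 := by
        obtain ⟨M, hM, hQM⟩ := Q.asIdeal.exists_le_maximal Q.isPrime.ne_top
        have h := Ideal.height_le_ringKrullDim_quotient_add_one (hQM hfQ)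
        rw [hdim, height_of_isMaximal_fin] at h
        exact_mod_cast h
      obtain ⟨Q', rfl⟩ := PrimeSpectrum.exists_comap_mk_eq (I := I) Q
        ((Ideal.span_singleton_le_iff_mem _).mpr hfQ)
      have h1 := ih s hlt (φ Q')
      rw [← (hφ Q').1, ← (hφ Q').2] at h1
      rw [← PrimeSpectrum.coheight_comap_mk]
      calc (N : ℕ∞) ≤ s + 1 := by exact_mod_cast hle
        _ ≤ height Q' + coheight Q' + 1 := by gcongr
        _ = height Q' + 1 + coheight Q' := by ring
        _ ≤ _ := by
          gcongr
          exact PrimeSpectrum.height_add_one_le_height_comap_mk hI Q'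

variable (K) in
/-- The dimension formula for domains of finite type over a field. -/
theorem PrimeSpectrum.height_add_coheight_eq {B : Type*} [CommRing B] [IsDomain B]
    [Algebra K B] [Algebra.FiniteType K B] (Q : PrimeSpectrum B) :
    height Q + coheight Q = coheight (⊥ : PrimeSpectrum B) := by
  refine le_antisymm ?_ ?_
  · rw [← WithBot.coe_le_coe, coheight_bot_eq_krullDim]
    exact height_add_coheight_le_krullDim Q
  · obtain ⟨s, φ, hφ, hs⟩ := exists_height_eq_coheight_eq_fin K B
    rw [hs, (hφ Q).1, (hφ Q).2]
    exact MvPolynomial.le_height_add_coheight_fin s _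

variable (K) in
/-- In a domain of finite type over a field, adding one equation to a prime ideal raises the height
by at most one. -/
theorem Ideal.height_le_height_add_one_of_mem_minimalPrimes_sup {B : Type*} [CommRing B]
    [IsDomain B] [Algebra K B] [Algebra.FiniteType K B] {Q P : Ideal B} [hQ : Q.IsPrime] {y : B}
    (hP : P ∈ (Q ⊔ Ideal.span {y}).minimalPrimes) : P.height ≤ Q.height + 1 := by
  have hPp := hP.1.1
  have : IsNoetherianRing B := Algebra.FiniteType.isNoetherianRing K B
  have hQP : Q ≤ P := le_sup_left.trans hP.1.2
  obtain ⟨P', hP'⟩ := PrimeSpectrum.exists_comap_mk_eq (I := Q) ⟨P, hPp⟩ hQP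
  have hP'P : P'.asIdeal.comap (Ideal.Quotient.mk Q) = P := congrArg PrimeSpectrum.asIdeal hP'
  have hmin : P'.asIdeal ∈ (Ideal.span {Ideal.Quotient.mk Q y}).minimalPrimes := by
    refine ⟨⟨P'.isPrime, ?_⟩, ?_⟩
    · rw [Ideal.span_singleton_le_iff_mem, ← Ideal.mem_comap, hP'P]
      exact hP.1.2 (Ideal.mem_sup_right (Ideal.mem_span_singleton_self y))
    · rintro q ⟨hq, hyq⟩ hle
      have h := hP.2 (y := q.comap (Ideal.Quotient.mk Q)) ⟨inferInstance, sup_le ?_ ?_⟩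
        (hP'P ▸ Ideal.comap_mono hle)
      · rw [← hP'P] at h
        exact (Ideal.comap_le_comap_iff_of_surjective _ Ideal.Quotient.mk_surjective _ _).mp h
      · intro x hx
        simp [Ideal.Quotient.eq_zero_iff_mem.mpr hx]
      · rw [Ideal.span_singleton_le_iff_mem, Ideal.mem_comap]
        exact hyq (Ideal.mem_span_singleton_self _)
  have h1 : Order.height P' ≤ 1 := by
    rw [← PrimeSpectrum.height_eq_orderHeight]
    exact Ideal.height_le_one_of_isPrincipal_of_mem_minimalPrimes _ _ hmin
  -- Comparing the dimension formula in `B ⧸ Q` and in `B` gives `ht P = ht Q + ht P'`, once all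
  -- terms are known to be finite.
  have e1 := PrimeSpectrum.height_add_coheight_eq K P'
  have e2 := PrimeSpectrum.height_add_coheight_eq K (⟨P, hPp⟩ : PrimeSpectrum B)
  have e3 := PrimeSpectrum.height_add_coheight_eq K (⟨Q, hQ⟩ : PrimeSpectrum B)
  have hbot : PrimeSpectrum.comap (Ideal.Quotient.mk Q) ⊥ = ⟨Q, hQ⟩ := by
    refine PrimeSpectrum.ext ?_
    exact Ideal.mk_ker
  rw [PrimeSpectrum.coheight_comap_mk Q ⊥, hbot, PrimeSpectrum.coheight_comap_mk, hP'] at e1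
  rw [← PrimeSpectrum.height_eq_orderHeight] at e2 e3
  obtain ⟨s, -, -, hs⟩ := PrimeSpectrum.exists_height_eq_coheight_eq_fin K B
  rw [hs] at e2 e3
  have f1 : coheight (⟨P, hPp⟩ : PrimeSpectrum B) ≠ ⊤ := fun h ↦ by simp [h] at e2
  have f2 : coheight (⟨Q, hQ⟩ : PrimeSpectrum B) ≠ ⊤ := fun h ↦ by simp [h] at e3
  have f3 : P.height ≠ ⊤ := fun h ↦ by simp [h] at e2
  have f4 : Q.height ≠ ⊤ := fun h ↦ by simp [h] at e3
  generalize coheight (⟨P, hPp⟩ : PrimeSpectrum B) = a at *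
  generalize coheight (⟨Q, hQ⟩ : PrimeSpectrum B) = b at *
  have f5 : Order.height P' ≠ ⊤ := ne_top_of_le_ne_top (by simp) h1
  generalize Order.height P' = c at *
  generalize P.height = p at *
  generalize Q.height = q at *
  lift a to ℕ using f1
  lift b to ℕ using f2
  lift p to ℕ using f3
  lift q to ℕ using f4
  lift c to ℕ using f5
  norm_cast at *
  omega

end Dimension

/-! ### Adjoining the variable `y` -/

/-- The preimage is `p + (y)`. Going-down for `S → S[y]` adds to `ht p` the height of its image
modulo `pS[y]`, a principal ideal generated by the nonzero nonunit `y`. -/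
theorem Polynomial.height_comap_constantCoeff {S : Type*} [CommRing S] [IsNoetherianRing S]
    (p : Ideal S) [hp : p.IsPrime] :
    (p.comap (Polynomial.constantCoeff (R := S))).height = p.height + 1 := by
  let P := p.comap (Polynomial.constantCoeff (R := S))
  have hover : P.LiesOver p := ⟨by ext x; simp [P, Ideal.mem_comap, Ideal.under]⟩
  have hprime : (p.map (algebraMap S (Polynomial S))).IsPrime := Ideal.isPrime_map_C_of_isPrime
  have hle : p.map (algebraMap S (Polynomial S)) ≤ P := by
    rw [Ideal.map_le_iff_le_comap]
    intro x hx
    simpa [P] using hx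
  let f := Ideal.Quotient.mk (p.map (algebraMap S (Polynomial S)))
  have hspan : P.map f = Ideal.span {f Polynomial.X} := by
    refine le_antisymm ?_ ?_
    · rw [Ideal.map_le_iff_le_comap]
      intro q hq
      have hq0 : q.coeff 0 ∈ p := hq
      have h0 : f (Polynomial.C (q.coeff 0)) = 0 :=
        Ideal.Quotient.eq_zero_iff_mem.mpr (Ideal.mem_map_of_mem _ hq0)
      rw [Ideal.mem_comap, ← Polynomial.divX_mul_X_add q, map_add, h0, add_zero, map_mul]
      exact Ideal.mul_mem_left _ _ (Ideal.mem_span_singleton_self _)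
    · rw [Ideal.span_singleton_le_iff_mem]
      exact Ideal.mem_map_of_mem _ (by simp [P])
  have hX : f Polynomial.X ≠ 0 := by
    intro h
    have := Ideal.mem_map_C_iff.mp (Ideal.Quotient.eq_zero_iff_mem.mp h) 1
    rw [Polynomial.coeff_X_one] at this
    exact hp.ne_top (p.eq_top_iff_one.mpr this)
  have hunit : ¬ IsUnit (f Polynomial.X) := by
    intro h
    have hP : (P.map f).comap f = ⊤ := by
      rw [hspan, Ideal.span_singleton_eq_top.mpr h, Ideal.comap_top]
    rw [Ideal.comap_map_of_surjective _ Ideal.Quotient.mk_surjective, ← RingHom.ker_eq_comap_bot,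
      Ideal.mk_ker, sup_eq_left.mpr hle] at hP
    exact (inferInstance : P.IsPrime).ne_top hP
  change P.height = _
  rw [Ideal.height_eq_height_add_of_liesOver_of_hasGoingDown p P]
  change _ + (P.map f).height = _
  rw [hspan, Ideal.height_span_singleton_eq_one_of_mem_nonZeroDivisors
    (mem_nonZeroDivisors_of_ne_zero hX) hunit]

theorem Polynomial.height_comap_constantCoeff_le {S : Type*} [CommRing S] [IsNoetherianRing S]
    (I : Ideal S) : (I.comap (Polynomial.constantCoeff (R := S))).height ≤ I.height + 1 := by
  by_cases hI : I = ⊤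
  · simp [hI]
  obtain ⟨k, hk⟩ := ENat.ne_top_iff_exists.mp (Ideal.height_ne_top hI)
  obtain ⟨p, hp, hIp, hpk⟩ := Ideal.exists_isPrime_height_eq hk.symm
  rw [← hk, ← hpk, ← height_comap_constantCoeff p]
  exact Ideal.height_mono (Ideal.comap_mono hIp)

section AddVarMul

variable {K S : Type*} [CommRing K] [CommRing S] [Algebra K S] {m n : ℕ}
  (X : Matrix (Fin m) (Fin n) S) (A : Matrix (Fin m) (Fin n) K)

theorem addVarMul_apply (i : Fin m) (k : Fin n) :
    addVarMul X A i k =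
      Polynomial.C (X i k) + Polynomial.X * algebraMap K (Polynomial S) (A i k) := by
  simp [addVarMul]

theorem map_constantCoeff_addVarMul : (addVarMul X A).map Polynomial.constantCoeff = X := by
  ext i k
  simp [addVarMul_apply]

theorem minorsIdeal_addVarMul_le_comap (j : ℕ) :
    minorsIdeal j (addVarMul X A) ≤ (minorsIdeal j X).comap Polynomial.constantCoeff := by
  rw [← Ideal.map_le_iff_le_comap, map_minorsIdeal, map_constantCoeff_addVarMul]

theorem minorsIdeal_addVarMul_height_le [IsNoetherianRing S] (j : ℕ) :
    (minorsIdeal j (addVarMul X A)).height ≤ (minorsIdeal j X).height + 1 :=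
  (Ideal.height_mono (minorsIdeal_addVarMul_le_comap X A j)).trans
    (Polynomial.height_comap_constantCoeff_le _)

variable {X A} in
theorem minorsIdeal_height_add_one_le_of_X_mem [IsNoetherianRing S] {j : ℕ}
    {Q : Ideal (Polynomial S)} [hQ : Q.IsPrime] (hJ : minorsIdeal j (addVarMul X A) ≤ Q)
    (hX : Polynomial.X ∈ Q) : (minorsIdeal j X).height + 1 ≤ Q.height := by
  let p := Q.comap (Polynomial.C (R := S))
  have hpQ : p.comap Polynomial.constantCoeff = Q := by
    ext q
    have : q - Polynomial.C (q.coeff 0) ∈ Q := by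
      rw [sub_eq_iff_eq_add.mpr (Polynomial.divX_mul_X_add q).symm]
      exact Ideal.mul_mem_left _ _ hX
    change Polynomial.C (q.coeff 0) ∈ Q ↔ q ∈ Q
    exact ⟨fun h ↦ by simpa using Q.add_mem this h, fun h ↦ by simpa using Q.sub_mem h this⟩
  have hIp : minorsIdeal j X ≤ p := by
    rw [← map_constantCoeff_addVarMul X A, ← map_minorsIdeal, Ideal.map_le_iff_le_comap, hpQ]
    exact hJ
  rw [← hpQ, Polynomial.height_comap_constantCoeff p]
  gcongr

end AddVarMul

/-- For a generic scalar matrix `A`, the determinantal ideals of `X + yA` have generic height away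
from `y = 0`. -/
theorem exists_le_height_of_X_notMem {K S : Type*} [Field K] [Infinite K] [CommRing S]
    [IsNoetherianRing S] [Algebra K S] {m n : ℕ} (X : Matrix (Fin m) (Fin n) S) :
    ∃ A : Matrix (Fin m) (Fin n) K, ∀ j, ∀ Q : Ideal (Polynomial S), Q.IsPrime →
      minorsIdeal (j + 1) (addVarMul X A) ≤ Q → Polynomial.X ∉ Q →
      (((m - j) * (n - j) : ℕ) : ℕ∞) ≤ Q.height := by
  let y : Polynomial S := Polynomial.X
  let L := Localization.Away y
  let f := algebraMap (Polynomial S) L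
  have : IsNoetherianRing L := IsLocalization.isNoetherianRing (Submonoid.powers y) L inferInstance
  -- `Z = y⁻¹X`, so `X + yA = y(Z + A)` with `y` a unit; localization keeps the height of `Q`.
  let Z : Matrix (Fin m) (Fin n) L :=
    Matrix.of fun i k ↦ IsLocalization.Away.invSelf y * f (Polynomial.C (X i k))
  obtain ⟨A, hA⟩ := exists_translate_minorsIdeal_height_le K Z
  refine ⟨A, fun j Q hQ hJ hy ↦ ?_⟩
  have hdisj : Disjoint (Submonoid.powers y : Set (Polynomial S)) (Q : Set (Polynomial S)) :=
    (Ideal.disjoint_powers_iff_notMem_of_isPrime y).mpr hy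
  have hprime := IsLocalization.isPrime_of_isPrime_disjoint (Submonoid.powers y) L Q hQ hdisj
  rw [← IsLocalization.height_map_of_disjoint (S := L) (Submonoid.powers y) Q hdisj]
  refine hA j _ hprime ?_
  have hyu : IsUnit (f y) := IsLocalization.Away.algebraMap_isUnit y
  have hsmul : f y • (Z + A.map (algebraMap K L)) = (addVarMul X A).map f := by
    ext i k
    have : f (algebraMap K (Polynomial S) (A i k)) = algebraMap K L (A i k) :=
      (IsScalarTower.algebraMap_apply K (Polynomial S) L (A i k)).symm
    simp only [Matrix.smul_apply, Matrix.add_apply, Matrix.map_apply, addVarMul_apply, map_add,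
      map_mul, this, smul_eq_mul, mul_add, Z, Matrix.of_apply]
    rw [← mul_assoc, IsLocalization.Away.mul_invSelf, one_mul]
  rw [minorsIdeal_le_iff]
  intro r c
  have hmem : (((addVarMul X A).map f).submatrix r c).det ∈ Q.map f := by
    have h := Ideal.map_mono (f := f) hJ
    rw [map_minorsIdeal] at h
    exact h (Matrix.det_submatrix_mem_minorsIdeal _ _ _)
  have hs : (f y • (Z + A.map (algebraMap K L))).submatrix r c =
    f y • (Z + A.map (algebraMap K L)).submatrix r c := rfl
  rw [← hsmul, hs, Matrix.det_smul] at hmem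
  exact (Ideal.unit_mul_mem_iff_mem _ (hyu.pow _)).mp hmem

/-! ### Matrices of linear forms -/

section Homogeneous

variable {K : Type*} [Field K] {m n : ℕ}

theorem MvPolynomial.isHomogeneous_det {R τ : Type*} [CommRing R] {j : ℕ}
    {Y : Matrix (Fin j) (Fin j) (MvPolynomial τ R)} (hY : ∀ i k, (Y i k).IsHomogeneous 1) :
    Y.det.IsHomogeneous j := by
  rw [Matrix.det_apply, ← mem_homogeneousSubmodule]
  refine Submodule.sum_mem _ fun s _ ↦ ?_
  rw [Units.smul_def]
  refine zsmul_mem ?_ _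
  rw [mem_homogeneousSubmodule]
  simpa using IsHomogeneous.prod Finset.univ (fun i ↦ Y (s i) i) (fun _ ↦ 1) fun i _ ↦ hY _ _

/-- Minimal primes of a homogeneous ideal are homogeneous, so a nonzero constant term would itself
be a unit in `Q`. -/
theorem MvPolynomial.minimalPrimes_minorsIdeal_le_ker {τ : Type*}
    {Y : Matrix (Fin m) (Fin n) (MvPolynomial τ K)} (hY : ∀ i k, (Y i k).IsHomogeneous 1) {j : ℕ}
    {Q : Ideal (MvPolynomial τ K)} (hQ : Q ∈ (minorsIdeal j Y).minimalPrimes) :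
    Q ≤ RingHom.ker (constantCoeff (R := K) (σ := τ)) := by
  let _ : GradedAlgebra (homogeneousSubmodule τ K) := gradedAlgebra
  have hQp := hQ.1.1
  have hJ : (minorsIdeal j Y).IsHomogeneous (homogeneousSubmodule τ K) := by
    refine Ideal.homogeneous_span _ _ ?_
    rintro _ ⟨r, c, rfl⟩
    exact ⟨j, isHomogeneous_det fun i k ↦ hY _ _⟩
  let Q' := Q.homogeneousCore (homogeneousSubmodule τ K)
  have hQ' : Q'.toIdeal.IsPrime := hQp.homogeneousCore
  have hle : Q'.toIdeal ≤ Q := Ideal.toIdeal_homogeneousCore_le _ _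
  have hJQ' : minorsIdeal j Y ≤ Q'.toIdeal := by
    have h := Ideal.homogeneousCore_mono (homogeneousSubmodule τ K) hQ.1.2
    have h' := hJ.toIdeal_homogeneousCore_eq_self
    rw [← h']
    exact h
  have hQQ' : Q ≤ Q'.toIdeal := hQ.2 ⟨hQ', hJQ'⟩ hle
  intro q hq
  rw [RingHom.mem_ker]
  by_contra hne
  have h0 : homogeneousComponent 0 q ∈ Q'.toIdeal := by
    have := Q'.isHomogeneous 0 (hQQ' hq)
    rwa [← decomposition.decompose'_apply]
  rw [homogeneousComponent_zero] at h0
  exact hQ'.ne_top (Ideal.eq_top_of_isUnit_mem _ h0 ((IsUnit.mk0 _ hne).map C))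

variable {σ : Type*}

theorem MvPolynomial.optionEquivLeft_symm_algebraMap (p : MvPolynomial σ K) :
    (optionEquivLeft K σ).symm (Polynomial.C p) = rename some p := by
  rw [AlgEquiv.symm_apply_eq]
  induction p using MvPolynomial.induction_on with
  | C a => simp
  | add p q hp hq => rw [map_add, map_add, map_add, hp, hq]
  | mul_X p i hp => rw [map_mul, map_mul, map_mul, hp, rename_X, optionEquivLeft_X_some]

theorem isHomogeneous_optionEquivLeft_symm_addVarMul
    {X : Matrix (Fin m) (Fin n) (MvPolynomial σ K)} (hX : ∀ i k, (X i k).IsHomogeneous 1)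
    (A : Matrix (Fin m) (Fin n) K) (i : Fin m) (k : Fin n) :
    ((MvPolynomial.optionEquivLeft K σ).symm (addVarMul X A i k)).IsHomogeneous 1 := by
  rw [addVarMul_apply, map_add, map_mul, MvPolynomial.optionEquivLeft_symm_algebraMap,
    MvPolynomial.optionEquivLeft_symm_X, AlgEquiv.commutes]
  exact (hX i k).rename_isHomogeneous.add
    ((MvPolynomial.isHomogeneous_X K _).mul (MvPolynomial.isHomogeneous_C _ _))

/-- Homogeneity puts `Q` and `y` in a common prime, so some `P` is minimal over `Q + (y)`; then `ht
I_j(X) + 1 ≤ ht P ≤ ht Q + 1`. -/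
theorem minorsIdeal_height_le_addVarMul_height [Finite σ]
    {X : Matrix (Fin m) (Fin n) (MvPolynomial σ K)} (hX : ∀ i k, (X i k).IsHomogeneous 1)
    (A : Matrix (Fin m) (Fin n) K) (j : ℕ) :
    (minorsIdeal j X).height ≤ (minorsIdeal j (addVarMul X A)).height := by
  rw [Ideal.height_eq_inf_minimalPrimes (minorsIdeal j (addVarMul X A))]
  refine le_iInf₂ fun Q hQ ↦ ?_
  have hQp := hQ.1.1
  let e := (MvPolynomial.optionEquivLeft K σ).symm.toRingEquiv
  let φ : Polynomial (MvPolynomial σ K) →+* K := MvPolynomial.constantCoeff.comp e.toRingHom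
  have hQφ : Q ≤ RingHom.ker φ := by
    have hQ' : Q.comap e.symm ∈
        (minorsIdeal j ((addVarMul X A).map e.toRingHom)).minimalPrimes := by
      rw [← map_minorsIdeal]
      have h1 : (minorsIdeal j (addVarMul X A)).map e.toRingHom =
          (minorsIdeal j (addVarMul X A)).comap e.symm.toRingHom :=
        Ideal.map_comap_of_equiv e
      rw [h1, Ideal.comap_minimalPrimes_eq_of_surjective (f := e.symm.toRingHom) e.symm.surjective]
      exact ⟨Q, hQ, rfl⟩
    have h := MvPolynomial.minimalPrimes_minorsIdeal_le_ker
      (isHomogeneous_optionEquivLeft_symm_addVarMul hX A) hQ'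
    intro q hq
    exact h (show e q ∈ Q.comap e.symm by simpa [Ideal.mem_comap] using hq)
  have hXφ : Polynomial.X ∈ RingHom.ker φ := by
    rw [RingHom.mem_ker]
    change MvPolynomial.constantCoeff ((MvPolynomial.optionEquivLeft K σ).symm Polynomial.X) = 0
    simp
  have hker : (RingHom.ker φ).IsPrime := RingHom.ker_isPrime φ
  obtain ⟨P, hP, -⟩ := Ideal.exists_minimalPrimes_le
    (sup_le hQφ ((Ideal.span_singleton_le_iff_mem _).mpr hXφ))
  have hPp := hP.1.1
  have h1 := minorsIdeal_height_add_one_le_of_X_mem (X := X) (A := A)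
    (hQ.1.2.trans (le_sup_left.trans hP.1.2))
    (hP.1.2 (Ideal.mem_sup_right (Ideal.mem_span_singleton_self _)))
  have h2 := h1.trans (Ideal.height_le_height_add_one_of_mem_minimalPrimes_sup K hP)
  exact (ENat.add_le_add_iff_right ENat.one_ne_top).mp h2

/-- All `j`-minors of `X` may vanish on the locus, so `X` is first deformed to `X + yA`, which does
not lower the height, with `A = E * F` of rank `j`. -/
theorem minorsIdeal_succ_height_le_mul [Finite σ]
    {X : Matrix (Fin m) (Fin n) (MvPolynomial σ K)} (hX : ∀ i k, (X i k).IsHomogeneous 1)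
    {j : ℕ} (hm : j ≤ m) (hn : j ≤ n) :
    (minorsIdeal (j + 1) X).height ≤ (((m - j) * (n - j) : ℕ) : ℕ∞) := by
  let E : Matrix (Fin m) (Fin j) K := Matrix.of fun i l ↦ if i = Fin.castLE hm l then 1 else 0
  let F : Matrix (Fin j) (Fin n) K := Matrix.of fun l k ↦ if Fin.castLE hn l = k then 1 else 0
  -- Evaluation at the point `x = 0`, `y = 1`, where the deformed matrix becomes `E * F`, with
  -- leading `j`-minor equal to `1`.
  let φ : Polynomial (MvPolynomial σ K) →+* K :=
    Polynomial.eval₂RingHom MvPolynomial.constantCoeff 1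
  have hφ : (addVarMul X (E * F)).map φ = E * F := by
    ext i k
    have h0 : MvPolynomial.constantCoeff (X i k) = 0 := by
      rw [MvPolynomial.constantCoeff_eq]
      exact (hX i k).coeff_eq_zero (by simp)
    have h1 : φ (algebraMap K _ ((E * F) i k)) = (E * F) i k := by
      rw [IsScalarTower.algebraMap_apply K (MvPolynomial σ K), Polynomial.algebraMap_eq]
      simp [φ]
    rw [Matrix.map_apply, addVarMul_apply, map_add, map_mul, h1]
    simp [φ, h0]
  have hle : minorsIdeal (j + 1) (addVarMul X (E * F)) ≤ RingHom.ker φ := by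
    rw [RingHom.ker_eq_comap_bot, ← Ideal.map_le_iff_le_comap, map_minorsIdeal, hφ,
      minorsIdeal_mul_eq_bot (Nat.lt_succ_self j)]
  have hker : (RingHom.ker φ).IsPrime := RingHom.ker_isPrime φ
  obtain ⟨P, hP, hPφ⟩ := Ideal.exists_minimalPrimes_le hle
  have hδ : ((addVarMul X (E * F)).submatrix (Fin.castLE hm) (Fin.castLE hn)).det ∉ P := by
    intro h
    have h := RingHom.mem_ker.mp (hPφ h)
    have hsub : φ.mapMatrix ((addVarMul X (E * F)).submatrix (Fin.castLE hm) (Fin.castLE hn)) =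
        ((addVarMul X (E * F)).map φ).submatrix (Fin.castLE hm) (Fin.castLE hn) := rfl
    have hone : (E * F).submatrix (Fin.castLE hm) (Fin.castLE hn) = 1 := by
      have hE : E.submatrix (Fin.castLE hm) id = 1 := by
        ext i l; simp [E, Matrix.one_apply]
      have hF : F.submatrix id (Fin.castLE hn) = 1 := by
        ext i l; simp [F, Matrix.one_apply]
      have : (E * F).submatrix (Fin.castLE hm) (Fin.castLE hn) =
        E.submatrix (Fin.castLE hm) id * F.submatrix id (Fin.castLE hn) := rfl
      rw [this, hE, hF, one_mul]
    rw [RingHom.map_det, hsub, hφ, hone, Matrix.det_one] at h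
    exact one_ne_zero h
  exact (minorsIdeal_height_le_addVarMul_height hX (E * F) (j + 1)).trans
    ((Ideal.height_mono hP.1.2).trans (height_le_of_mem_minimalPrimes_minorsIdeal hP hδ))

/-- `S[y]` is a polynomial ring in one more variable, where `X + yA` is again a matrix of linear
forms. -/
theorem minorsIdeal_succ_addVarMul_height_le_mul [Finite σ]
    {X : Matrix (Fin m) (Fin n) (MvPolynomial σ K)} (hX : ∀ i k, (X i k).IsHomogeneous 1)
    (A : Matrix (Fin m) (Fin n) K) {j : ℕ} (hm : j ≤ m) (hn : j ≤ n) :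
    (minorsIdeal (j + 1) (addVarMul X A)).height ≤ (((m - j) * (n - j) : ℕ) : ℕ∞) := by
  let e := (MvPolynomial.optionEquivLeft K σ).symm.toRingEquiv
  have h := minorsIdeal_succ_height_le_mul
    (X := (addVarMul X A).map e) (isHomogeneous_optionEquivLeft_symm_addVarMul hX A) hm hn
  have he : minorsIdeal (j + 1) ((addVarMul X A).map e) =
      (minorsIdeal (j + 1) (addVarMul X A)).map e :=
    (map_minorsIdeal e.toRingHom (j + 1) (addVarMul X A)).symm
  rwa [he, RingEquiv.height_map] at h

end Homogeneous

/-! ### The main theorem -/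

theorem lemma3p7 {K : Type*} [Field K] [Infinite K] {σ : Type*} [Finite σ] {m n : ℕ}
    (X : Matrix (Fin m) (Fin n) (MvPolynomial σ K))
    (hX : ∀ i k, (X i k).IsHomogeneous 1) :
    (∀ (A : Matrix (Fin m) (Fin n) K) (j : ℕ),
      (minorsIdeal j X).height ≤ (minorsIdeal j (addVarMul X A)).height ∧
      (minorsIdeal j (addVarMul X A)).height ≤ (minorsIdeal j X).height + 1) ∧
    (∃ A : Matrix (Fin m) (Fin n) K, ∀ j : ℕ, 1 ≤ j → j ≤ m → j ≤ n →
      (minorsIdeal j (addVarMul X A)).height =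
        min (((m + 1 - j) * (n + 1 - j) : ℕ) : ℕ∞) ((minorsIdeal j X).height + 1)) := by
  refine ⟨fun A j ↦ ⟨minorsIdeal_height_le_addVarMul_height hX A j,
    minorsIdeal_addVarMul_height_le X A j⟩, ?_⟩
  obtain ⟨A, hA⟩ := exists_le_height_of_X_notMem (K := K) X
  refine ⟨A, fun j hj hm hn ↦ ?_⟩
  obtain ⟨j, rfl⟩ : ∃ i, j = i + 1 := ⟨j - 1, by omega⟩
  rw [Nat.add_sub_add_right, Nat.add_sub_add_right]
  refine le_antisymm (le_min
    (minorsIdeal_succ_addVarMul_height_le_mul hX A (by omega) (by omega))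
    (minorsIdeal_addVarMul_height_le X A _)) ?_
  rw [Ideal.height_eq_inf_minimalPrimes (minorsIdeal (j + 1) (addVarMul X A))]
  refine le_iInf₂ fun Q hQ ↦ ?_
  have hQp := hQ.1.1
  by_cases hy : Polynomial.X ∈ Q
  · exact (min_le_right _ _).trans (minorsIdeal_height_add_one_le_of_X_mem hQ.1.2 hy)
  · exact (min_le_left _ _).trans (hA j Q hQp hQ.1.2 hy)
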